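/- Let $P$ be a $3$-dimensional simplicial convex polytope, i.e. the convex hull of finitely many points in some $\mathbb{R}^m$, with $3$-dimensional affine span, all of whose proper faces are simplices. Let $V(P)$ be its vertex set, $n=|V(P)|$, and let $\Delta(P)$ be its boundary complex, i.e. the simplicial complex of vertex sets of proper faces of $P$ (including the empty face). For $W\subseteq V(P)$ let $P|_W$ be the simplicial complex $\{F\cap W: F\in\Delta(P)\}$. Let $\mathbf{k}$ be an arbitrary field, and define the graded Betti numbers $$\beta_{i,j}(P)=\sum_{W\subseteq V(P),\ |W|=j}\dim_{\mathbf{k}}\widetilde H_{j-i-1}(P|_W;\mathbf{k}),$$ where $\widetilde H$ denotes reduced simplicial homology, and the special graded Betti numbers $b_i(P)=\beta_{i-1,i}(P)$. Then $$n=\frac{7+\sqrt{8\,b_2(P)+1}}{2}\qquad\text{and}\qquad b_2(P)=\binom{n}{2}-3n+6.$$ -/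

import Mathlib

open scoped BigOperators

noncomputable section

/-! ### Reduced simplicial homology

A simplicial complex on vertices in `α` is given by its set `K` of faces (the empty face included).
Homology is computed from the augmented ordered chain complex: in degree `d` it is spanned by the
tuples `(v₀, …, v_d)` of (not necessarily distinct) vertices that span a face of `K`;
degree `-1` is spanned by the empty tuple. -/

namespace SimplicialHomology

variable {α : Type*} (k : Type*) [Field k]

/-- The boundary map `(v₀, …, v_d) ↦ ∑ i, (-1)^i (v₀, …, v̂_i, …, v_d)` on formal combinations of
tuples. On `1`-tuples it is the augmentation, and it kills the empty tuple. -/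
def boundary : (List α →₀ k) →ₗ[k] (List α →₀ k) :=
  Finsupp.linearCombination k fun t : List α =>
    ∑ i ∈ Finset.range t.length, Finsupp.single (t.eraseIdx i) ((-1 : k) ^ i)

theorem boundary_single (t : List α) :
    boundary k (Finsupp.single t 1) =
      ∑ i ∈ Finset.range t.length, Finsupp.single (t.eraseIdx i) ((-1 : k) ^ i) := by
  simp [boundary]

/-- Prepending a vertex to every tuple. -/
def cone (v : α) : (List α →₀ k) →ₗ[k] (List α →₀ k) :=
  Finsupp.lmapDomain k k (List.cons v)

theorem boundary_cone (v : α) (c : List α →₀ k) :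
    boundary k (cone k v c) = c - cone k v (boundary k c) := by
  induction c using Finsupp.induction_linear with
  | zero => simp
  | add f g hf hg => simp only [map_add, hf, hg]; abel
  | single t a =>
    have h : Finsupp.single t a = a • Finsupp.single t (1 : k) := by simp
    rw [h]
    simp only [map_smul, ← smul_sub]
    congr 1
    have h2 : cone k v (Finsupp.single t (1 : k)) = Finsupp.single (v :: t) 1 := by
      simp [cone]
    rw [h2, boundary_single, boundary_single, List.length_cons, Finset.sum_range_succ']
    simp only [cone, List.eraseIdx_cons_succ, List.eraseIdx_cons_zero, pow_zero, map_sum,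
      Finsupp.lmapDomain_apply, Finsupp.mapDomain_single, pow_succ, mul_neg, mul_one,
      Finsupp.single_neg, Finset.sum_neg_distrib]
    abel

/-- The boundary map is a differential. -/
theorem boundary_boundary (c : List α →₀ k) : boundary k (boundary k c) = 0 := by
  induction c using Finsupp.induction_linear with
  | zero => simp
  | add f g hf hg => simp only [map_add, hf, hg, add_zero]
  | single t a =>
    have h : Finsupp.single t a = a • Finsupp.single t (1 : k) := by simp
    rw [h]
    simp only [map_smul]
    suffices h' : boundary k (boundary k (Finsupp.single t (1 : k))) = 0 by rw [h', smul_zero]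
    induction t with
    | nil => simp [boundary_single]
    | cons v t ih =>
      have h2 : Finsupp.single (v :: t) (1 : k) = cone k v (Finsupp.single t 1) := by
        simp [cone]
      rw [h2, boundary_cone, map_sub, boundary_cone, ih (by simp), map_zero, sub_zero, sub_self]

/-- The `d`-chains of `K`: combinations of `(d+1)`-tuples whose entries span a face of `K`. -/
def chains (K : Set (Set α)) (d : ℤ) : Submodule k (List α →₀ k) :=
  Finsupp.supported k k {t : List α | (t.length : ℤ) = d + 1 ∧ {v | v ∈ t} ∈ K}

/-- The (reduced) `d`-cycles of `K`. -/
def cycles (K : Set (Set α)) (d : ℤ) : Submodule k (List α →₀ k) :=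
  chains k K d ⊓ LinearMap.ker (boundary k)

/-- The `d`-boundaries of `K`. -/
def boundaries (K : Set (Set α)) (d : ℤ) : Submodule k (List α →₀ k) :=
  (chains k K (d + 1)).map (boundary k)

/-- The quotient `Z / (Z ∩ B)` of submodules of a vector space (so `Z / B` when `B ⊆ Z`). -/
abbrev Subquotient {M : Type*} [AddCommGroup M] [Module k M] (Z B : Submodule k M) : Type _ :=
  Z ⧸ B.comap Z.subtype

/-- The reduced homology of `K` in degree `d` with coefficients in `k`: cycles modulo boundaries. -/
abbrev ReducedHomology (K : Set (Set α)) (d : ℤ) : Type _ :=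
  Subquotient k (cycles k K d) (boundaries k K d)

end SimplicialHomology

/-- The restriction `{F ∩ W : F ∈ K}` of a simplicial complex to a set `W` of vertices. -/
def restrictComplex {α : Type*} (K : Set (Set α)) (W : Set α) : Set (Set α) :=
  {σ | ∃ F ∈ K, σ = F ∩ W}

/-! ### Convex polytopes -/

/-- A convex polytope: the convex hull of finitely many points. -/
structure ConvexPolytope (E : Type*) [AddCommGroup E] [Module ℝ E] where
  /-- The underlying set of points. -/
  carrier : Set E
  exists_eq_convexHull : ∃ S : Finset E, carrier = convexHull ℝ (S : Set E)

/-- A simplex: the convex hull of finitely many affinely independent points. -/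
def IsGeometricSimplex {E : Type*} [AddCommGroup E] [Module ℝ E] (F : Set E) : Prop :=
  ∃ S : Finset E, AffineIndependent ℝ (fun x : S => (x : E)) ∧ F = convexHull ℝ (S : Set E)

namespace ConvexPolytope

section

variable {E : Type*} [AddCommGroup E] [Module ℝ E]

/-- The dimension of a (nonempty) polytope: the dimension of its affine span. -/
def dim (P : ConvexPolytope E) : ℕ :=
  Module.finrank ℝ (affineSpan ℝ P.carrier).direction

end

variable {E : Type*} [AddCommGroup E] [Module ℝ E] [TopologicalSpace E]

/-- The proper faces of `P`: the empty set and the sets of points of `P` at which some continuous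
linear functional attains its maximum over `P`, other than `P` itself. -/
def IsProperFace (P : ConvexPolytope E) (F : Set E) : Prop :=
  IsExposed ℝ P.carrier F ∧ F ≠ P.carrier

/-- A polytope is simplicial if all of its proper faces are simplices. -/
def IsSimplicial (P : ConvexPolytope E) : Prop :=
  ∀ F : Set E, P.IsProperFace F → IsGeometricSimplex F

theorem finite_exposedPoints (P : ConvexPolytope E) : (P.carrier.exposedPoints ℝ).Finite := by
  obtain ⟨S, hS⟩ := P.exists_eq_convexHull
  refine S.finite_toSet.subset (exposedPoints_subset_extremePoints.trans ?_)
  rw [hS]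
  exact extremePoints_convexHull_subset

/-- The vertex set `V(P)`: the points `v` such that `{v}` is a face of `P`. -/
def vertices (P : ConvexPolytope E) : Finset E :=
  P.finite_exposedPoints.toFinset

/-- The boundary complex `Δ(P)`: the vertex sets of the proper faces of `P`. -/
def boundaryComplex (P : ConvexPolytope E) : Set (Set E) :=
  {σ | ∃ F : Set E, P.IsProperFace F ∧ σ = F ∩ (P.vertices : Set E)}

/-- The graded Betti number
`β_{i,j}(P) = ∑_{W ⊆ V(P), |W| = j} dim_k H̃_{j-i-1}(P|_W; k)`. -/
def gradedBetti (k : Type*) [Field k] (P : ConvexPolytope E) (i : ℤ) (j : ℕ) : ℕ :=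
  ∑ W ∈ P.vertices.powersetCard j,
    Module.finrank k
      (SimplicialHomology.ReducedHomology k
        (restrictComplex P.boundaryComplex (W : Set E)) ((j : ℤ) - i - 1))

/-- The special graded Betti number `b_i(P) = β_{i-1,i}(P)`. -/
def specialBetti (k : Type*) [Field k] (P : ConvexPolytope E) (i : ℕ) : ℕ :=
  P.gradedBetti k ((i : ℤ) - 1) i

end ConvexPolytope

end

/-!
Only sets `W` of two vertices contribute to `b₂`, and such a set contributes `1` if it is not an
edge and `0` if it is. Hence `b₂` is `n.choose 2` minus the number of edges, and everything follows
once the polytope is known to have `3 * n - 6` edges.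

The edges are counted without topology. Fix a linear functional `l` that is injective on the
vertices. Each triangle has exactly one vertex at which `l` takes its middle value, and conversely
each vertex `v` other than the minimum and the maximum of `l` is the middle vertex of exactly two
triangles: these are the triangles at `v` met by the plane `l = l v` away from `v`, and that plane
cuts the cone of the polytope at `v` in a pointed planar cone, which has two extreme rays. So there
are `2 * (n - 2)` triangles. Projecting along an edge also turns the polytope into a pointed planar
cone, so each edge lies in two triangles, and the number of edges is `3 / 2` times that of
triangles.
-/

section LinearAlgebra

open Module

variable {K E : Type*} [Field K] [AddCommGroup E] [Module K E]

theorem exists_linearIndependent_forall_eq_smul_add_smul (hE : finrank K E = 2)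
    {x : E} (hx : x ≠ 0) :
    ∃ y : E, LinearIndependent K ![x, y] ∧ ∀ z : E, ∃ p q : K, p • x + q • y = z := by
  have : FiniteDimensional K E := .of_finrank_pos (by lia)
  obtain ⟨y, hxy⟩ := exists_linearIndependent_pair_of_one_lt_finrank (R := K) (by lia) hx
  have hspan := hxy.span_eq_top_of_card_eq_finrank' (by rw [Fintype.card_fin, hE])
  rw [Matrix.range_cons_cons_empty] at hspan
  exact ⟨y, hxy, fun z => Submodule.mem_span_pair.1 (hspan ▸ Submodule.mem_top)⟩

theorem exists_dual_eq_of_linearIndependent {ι : Type*} {v : ι → E} (hv : LinearIndependent K v)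
    (g : ι → K) : ∃ f : Dual K E, ∀ i, f (v i) = g i := by
  obtain ⟨f, hf⟩ := LinearMap.exists_extend ((Basis.span hv).constr K g)
  refine ⟨f, fun i => ?_⟩
  have := LinearMap.congr_fun hf (Basis.span hv i)
  rwa [Basis.constr_basis, LinearMap.comp_apply, Submodule.subtype_apply,
    Basis.span_apply] at this

theorem exists_dual_eqOn_smul_add_smul {S : Set E} (hS : finrank K (Submodule.span K S) = 2)
    {φ : Dual K E} (hφ : ∃ x ∈ S, φ x ≠ 0) :
    ∃ ψ : Dual K E, (∀ c : K, ∃ x ∈ S, ψ x ≠ c * φ x) ∧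
      ∀ θ : Dual K E, ∃ p q : K, ∀ x ∈ S, θ x = p * φ x + q * ψ x := by
  obtain ⟨x₀, hx₀, hφx₀⟩ := hφ
  set U := Submodule.span K S
  have hdual : finrank K (Dual K U) = 2 := by rw [Subspace.dual_finrank_eq, hS]
  have hφU : φ.domRestrict U ≠ 0 := fun h =>
    hφx₀ (LinearMap.congr_fun h ⟨x₀, Submodule.subset_span hx₀⟩)
  obtain ⟨ψ', hφψ, hspan⟩ := exists_linearIndependent_forall_eq_smul_add_smul hdual hφU
  obtain ⟨ψ, hψ⟩ := LinearMap.exists_extend ψ'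
  refine ⟨ψ, fun c => ?_, fun θ => ?_⟩
  · by_contra! hc
    have hle : U ≤ LinearMap.ker (c • φ - ψ) := Submodule.span_le.2 fun x hx => by simp [hc x hx]
    have hdep : c • φ.domRestrict U + (-1 : K) • ψ' = 0 := by
      ext x
      simpa [← hψ, sub_eq_add_neg] using hle x.2
    exact neg_ne_zero.2 one_ne_zero (LinearIndependent.pair_iff.1 hφψ _ _ hdep).2
  · obtain ⟨p, q, hpq⟩ := hspan (θ.domRestrict U)
    refine ⟨p, q, fun x hx => ?_⟩
    simpa [← hψ] using (LinearMap.congr_fun hpq ⟨x, Submodule.subset_span hx⟩).symm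

theorem finrank_map_add_finrank_inf_ker {F : Type*} [AddCommGroup F] [Module K F] (f : E →ₗ[K] F)
    (D : Submodule K E) [FiniteDimensional K D] :
    finrank K (D.map f) + finrank K (D ⊓ LinearMap.ker f :) = finrank K D := by
  rw [← (f.domRestrict D).finrank_range_add_finrank_ker, LinearMap.range_domRestrict,
    LinearMap.ker_domRestrict, ← Submodule.map_comap_subtype, Submodule.finrank_map_subtype_eq]

theorem finrank_map_mkQ_add_finrank {N D : Submodule K E} [FiniteDimensional K D] (h : N ≤ D) :
    finrank K (D.map N.mkQ) + finrank K N = finrank K D := by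
  rw [← finrank_map_add_finrank_inf_ker N.mkQ D, Submodule.ker_mkQ, inf_eq_right.2 h]

theorem mkQ_vectorSpan_sub_eq_zero {S : Set E} {x y : E} (hx : x ∈ S) (hy : y ∈ S) :
    (vectorSpan K S).mkQ (x - y) = 0 :=
  (Submodule.Quotient.mk_eq_zero _).2 (vsub_mem_vectorSpan K hx hy)

theorem finrank_span_mkQ_add_finrank [DecidableEq E] {V σ : Finset E} {a : E} (hσV : σ ⊆ V)
    (ha : a ∈ σ) :
    finrank K (Submodule.span K ((fun x => (vectorSpan K (σ : Set E)).mkQ (x - a)) '' (V \ σ :))) +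
      finrank K (vectorSpan K (σ : Set E)) = finrank K (vectorSpan K (V : Set E)) := by
  have : FiniteDimensional K (vectorSpan K (V : Set E)) :=
    finiteDimensional_vectorSpan_of_finite K V.finite_toSet
  have hspan : Submodule.span K ((fun x => (vectorSpan K (σ : Set E)).mkQ (x - a)) '' (V \ σ :)) =
      (vectorSpan K (V : Set E)).map (vectorSpan K (σ : Set E)).mkQ := by
    rw [vectorSpan_eq_span_vsub_set_right K (Finset.mem_coe.2 (hσV ha)), Submodule.map_span,
      Set.image_image]
    refine le_antisymm (Submodule.span_mono ?_) (Submodule.span_le.2 ?_)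
    · exact Set.image_mono (Finset.coe_subset.2 Finset.sdiff_subset)
    · rintro _ ⟨x, hx, rfl⟩
      by_cases hxσ : x ∈ σ
      · change (vectorSpan K (σ : Set E)).mkQ (x - a) ∈ _
        rw [mkQ_vectorSpan_sub_eq_zero (Finset.mem_coe.2 hxσ) (Finset.mem_coe.2 ha)]
        exact zero_mem _
      · exact Submodule.subset_span ⟨x, Finset.mem_sdiff.2 ⟨hx, hxσ⟩, rfl⟩
  rw [hspan, finrank_map_mkQ_add_finrank (vectorSpan_mono K (Finset.coe_subset.2 hσV))]

theorem vectorSpan_le_ker {a : E} {S : Set E} {θ : Dual K E} (hθ : ∀ x ∈ S, θ (x - a) = 0) :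
    vectorSpan K S ≤ LinearMap.ker θ := by
  refine Submodule.span_le.2 ?_
  rintro _ ⟨x, hx, y, hy, rfl⟩
  change x - y ∈ LinearMap.ker θ
  rw [LinearMap.mem_ker, ← sub_sub_sub_cancel_right x y a, map_sub,
    hθ x hx, hθ y hy, sub_zero]

theorem finrank_vectorSpan_add_one_of_affineIndependent {σ : Finset E}
    (h : AffineIndependent K (fun x : σ => (x : E))) (hσ : σ.Nonempty) :
    finrank K (vectorSpan K (σ : Set E)) + 1 = σ.card := by
  obtain ⟨n, hn⟩ := Nat.exists_eq_add_one.2 hσ.card_pos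
  have hrank := h.finrank_vectorSpan ((Fintype.card_coe σ).trans hn)
  rw [Subtype.range_coe_subtype, show {x | x ∈ σ} = (σ : Set E) from rfl] at hrank
  rw [hrank, hn]

theorem finrank_vectorSpan_lt_card {V : Finset E} (hV : 0 < finrank K (vectorSpan K (V : Set E))) :
    finrank K (vectorSpan K (V : Set E)) < V.card := by
  classical
  have hne : V.Nonempty := by
    rw [Finset.nonempty_iff_ne_empty]
    rintro rfl
    rw [Finset.coe_empty, vectorSpan_empty, finrank_bot] at hV
    exact hV.false
  obtain ⟨n, hn⟩ := Nat.exists_eq_add_one.2 hne.card_pos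
  have := finrank_vectorSpan_image_finset_le K id V hn
  rw [Finset.image_id] at this
  lia

theorem exists_dual_injOn [Infinite K] (V : Finset E) : ∃ l : Dual K E, Set.InjOn l V := by
  obtain ⟨l, hl⟩ := exists_dual_forall_apply_ne_zero (K := K)
    (fun p : V.offDiag => p.1.1 - p.1.2) fun p => sub_ne_zero.2 (Finset.mem_offDiag.1 p.2).2.2
  refine ⟨l, fun x hx y hy hxy => by_contra fun hne => ?_⟩
  exact hl ⟨(x, y), Finset.mem_offDiag.2 ⟨hx, hy, hne⟩⟩ (by rw [map_sub, hxy, sub_self])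

end LinearAlgebra

/-! ### Faces of finitely generated cones -/

section ConeFaces

open Module

variable {𝕜 ι M : Type*} [Field 𝕜] [LinearOrder 𝕜] [AddCommGroup M] [Module 𝕜 M]

/-- `T` indexes the generators lying on a proper, possibly trivial, face of the cone generated by
the vectors `w i`, `i ∈ I`. -/
def IsConeFace (𝕜 : Type*) {ι M : Type*} [Field 𝕜] [LinearOrder 𝕜] [AddCommGroup M] [Module 𝕜 M]
    (w : ι → M) (I T : Finset ι) : Prop :=
  T ⊂ I ∧ ∃ θ : Dual 𝕜 M, ∀ i ∈ I, θ (w i) ≤ 0 ∧ (θ (w i) = 0 ↔ i ∈ T)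

theorem IsConeFace.mem_of_eq_zero {w : ι → M} {I T : Finset ι} (hT : IsConeFace 𝕜 w I T) {i : ι}
    (hi : i ∈ I) (hw : w i = 0) : i ∈ T := by
  obtain ⟨-, θ, hθ⟩ := hT
  exact (hθ i hi).2.1 (by rw [hw, map_zero])

/-- The pairs of generators on the negative and on the positive side of the hyperplane `l = 0`. -/
def crossingPairs (l : Dual 𝕜 M) (u : ι → M) (I : Finset ι) : Finset (ι × ι) :=
  (I ×ˢ I).filter fun p => l (u p.1) < 0 ∧ 0 < l (u p.2)

/-- For `p ∈ crossingPairs l u I`, a positive multiple of the point where the hyperplane `l = 0`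
crosses the segment from `u p.1` to `u p.2`. -/
def crossing (l : Dual 𝕜 M) (u : ι → M) (p : ι × ι) : M :=
  l (u p.2) • u p.1 - l (u p.1) • u p.2

theorem mem_crossingPairs {l : Dual 𝕜 M} {u : ι → M} {I : Finset ι} {p : ι × ι} :
    p ∈ crossingPairs l u I ↔ (p.1 ∈ I ∧ p.2 ∈ I) ∧ l (u p.1) < 0 ∧ 0 < l (u p.2) := by
  rw [crossingPairs, Finset.mem_filter, Finset.mem_product]

omit [LinearOrder 𝕜] in
theorem exists_dual_crossing_eq_of_eq_zero {u : ι → M} {l θ : Dual 𝕜 M} {a b : ι}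
    (ha : l (u a) ≠ 0) (hθ : θ (crossing l u (a, b)) = 0) :
    ∃ η : Dual 𝕜 M, (∀ p, η (crossing l u p) = θ (crossing l u p)) ∧ η (u a) = 0 ∧ η (u b) = 0 := by
  set η : Dual 𝕜 M := θ - (θ (u a) / l (u a)) • l
  have hη (p : ι × ι) : η (crossing l u p) = θ (crossing l u p) := by
    simp [η, crossing, mul_comm]
  have hηa : η (u a) = 0 := by simp [η, ha]
  refine ⟨η, hη, hηa, ?_⟩
  rw [← hη] at hθ
  simpa [crossing, hηa, ha] using hθ

theorem span_image_le_span_crossing_sup_span_singleton {u : ι → M} {I : Finset ι} {l : Dual 𝕜 M}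
    (hl : ∀ i ∈ I, l (u i) = 0 → u i = 0) {a b : ι}
    (hab : (a, b) ∈ crossingPairs l u I) : Submodule.span 𝕜 (u '' I) ≤
      Submodule.span 𝕜 (crossing l u '' crossingPairs l u I) ⊔ Submodule.span 𝕜 {u b} := by
  obtain ⟨⟨ha, hb⟩, hla, hlb⟩ := mem_crossingPairs.1 hab
  set S := Submodule.span 𝕜 (crossing l u '' crossingPairs l u I) ⊔ Submodule.span 𝕜 {u b}
  have hcS {p : ι × ι} (hp : p ∈ crossingPairs l u I) : crossing l u p ∈ S :=
    Submodule.mem_sup_left (Submodule.subset_span ⟨p, hp, rfl⟩)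
  have hbS : u b ∈ S := Submodule.mem_sup_right (Submodule.mem_span_singleton_self _)
  have hneg {i : ι} (hi : i ∈ I) (hi₀ : l (u i) < 0) : u i ∈ S := by
    have hib : crossing l u (i, b) ∈ S := hcS (mem_crossingPairs.2 ⟨⟨hi, hb⟩, hi₀, hlb⟩)
    rw [← S.smul_mem_iff hlb.ne', ← sub_add_cancel (l (u b) • u i) (l (u i) • u b)]
    exact S.add_mem hib (S.smul_mem _ hbS)
  refine Submodule.span_le.2 ?_
  rintro _ ⟨i, hi, rfl⟩
  rcases lt_trichotomy (l (u i)) 0 with hi₀ | hi₀ | hi₀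
  · exact hneg hi hi₀
  · rw [hl i hi hi₀]
    exact S.zero_mem
  · have hai : crossing l u (a, i) ∈ S := hcS (mem_crossingPairs.2 ⟨⟨ha, hi⟩, hla, hi₀⟩)
    rw [SetLike.mem_coe, ← S.smul_mem_iff hla.ne,
      ← sub_sub_cancel (l (u i) • u a) (l (u a) • u i)]
    exact S.sub_mem (S.smul_mem _ (hneg ha hla)) hai

theorem finrank_span_crossing {u : ι → M} {I : Finset ι} {l : Dual 𝕜 M}
    (hl : ∀ i ∈ I, l (u i) = 0 → u i = 0) (hI : (crossingPairs l u I).Nonempty) :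
    finrank 𝕜 (Submodule.span 𝕜 (crossing l u '' crossingPairs l u I)) + 1 =
      finrank 𝕜 (Submodule.span 𝕜 (u '' I)) := by
  obtain ⟨⟨a, b⟩, hab⟩ := hI
  obtain ⟨⟨-, hb⟩, -, hlb⟩ := mem_crossingPairs.1 hab
  have hDU := span_image_le_span_crossing_sup_span_singleton hl hab
  set U := Submodule.span 𝕜 (crossing l u '' crossingPairs l u I)
  set D := Submodule.span 𝕜 (u '' I)
  have huD {i : ι} (hi : i ∈ I) : u i ∈ D := Submodule.subset_span ⟨i, hi, rfl⟩
  have : FiniteDimensional 𝕜 D := .span_of_finite 𝕜 (I.finite_toSet.image u)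
  have hker : U ≤ LinearMap.ker l := Submodule.span_le.2 <| by
    rintro _ ⟨p, -, rfl⟩
    simp [crossing, mul_comm]
  have hUD : U < D := by
    refine SetLike.lt_iff_le_and_exists.2
      ⟨Submodule.span_le.2 ?_, u b, huD hb, fun hbU => hlb.ne' (hker hbU)⟩
    rintro _ ⟨p, hp, rfl⟩
    obtain ⟨⟨hp₁, hp₂⟩, -⟩ := mem_crossingPairs.1 hp
    exact D.sub_mem (D.smul_mem _ (huD hp₁)) (D.smul_mem _ (huD hp₂))
  have : FiniteDimensional 𝕜 U := Submodule.finiteDimensional_of_le hUD.le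
  have hlt := Submodule.finrank_lt_finrank_of_lt hUD
  have hle := (Submodule.finrank_mono hDU).trans
    (Submodule.finrank_add_le_finrank_add_finrank U (Submodule.span 𝕜 {u b}))
  rw [finrank_span_singleton fun h : u b = 0 => hlb.ne' (by rw [h, map_zero])] at hle
  lia

theorem IsConeFace.subset_of_crossingPairs_subset {u : ι → M} {I T T' : Finset ι} {l : Dual 𝕜 M}
    (hl : ∀ i ∈ I, l (u i) = 0 → u i = 0) (hT : T ⊆ I) (hT' : IsConeFace 𝕜 u I T')
    (hTne : (crossingPairs l u T).Nonempty) (h : crossingPairs l u T ⊆ crossingPairs l u T') :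
    T ⊆ T' := by
  obtain ⟨⟨a, b⟩, hab⟩ := hTne
  obtain ⟨⟨ha, hb⟩, hla, hlb⟩ := mem_crossingPairs.1 hab
  intro i hi
  rcases lt_trichotomy (l (u i)) 0 with hi₀ | hi₀ | hi₀
  · exact (mem_crossingPairs.1 (@h (i, b) (mem_crossingPairs.2 ⟨⟨hi, hb⟩, hi₀, hlb⟩))).1.1
  · exact hT'.mem_of_eq_zero (hT hi) (hl i (hT hi) hi₀)
  · exact (mem_crossingPairs.1 (@h (a, i) (mem_crossingPairs.2 ⟨⟨ha, hi⟩, hla, hi₀⟩))).1.2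

variable [IsStrictOrderedRing 𝕜]

theorem ncard_zeroSets_of_affine_nonneg {ρ : ι → 𝕜} {I : Finset ι}
    (hρ : ∃ i ∈ I, ∃ j ∈ I, ρ i ≠ ρ j) :
    {T : Finset ι | T.Nonempty ∧ T ⊂ I ∧
      ∃ p q : 𝕜, ∀ i ∈ I, 0 ≤ p + q * ρ i ∧ (p + q * ρ i = 0 ↔ i ∈ T)}.ncard = 2 := by
  obtain ⟨i, hi, j, hj, hij⟩ := hρ
  obtain ⟨m, hm, hmin⟩ := I.exists_min_image ρ ⟨i, hi⟩
  obtain ⟨M, hM, hmax⟩ := I.exists_max_image ρ ⟨i, hi⟩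
  have hmM : ρ m ≠ ρ M := by grind
  have hne : I.filter (ρ · = ρ m) ≠ I.filter (ρ · = ρ M) := fun h =>
    hmM (Finset.mem_filter.1 (h ▸ Finset.mem_filter.2 ⟨hm, rfl⟩ : m ∈ I.filter (ρ · = ρ M))).2
  rw [← Set.ncard_pair hne]
  congr 1
  ext T
  simp only [Set.mem_ofPred_eq, Set.mem_insert_iff, Set.mem_singleton_iff]
  constructor
  · rintro ⟨⟨t, ht⟩, hTI, p, q, hpq⟩
    have ht0 : p + q * ρ t = 0 := (hpq t (hTI.1 ht)).2.2 ht
    have hshift (i : ι) : p + q * ρ i = q * (ρ i - ρ t) := by linear_combination ht0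
    simp only [hshift, mul_eq_zero, sub_eq_zero] at hpq
    have hq : q ≠ 0 := by
      rintro rfl
      exact hTI.2 fun i hi => (hpq i hi).2.1 (Or.inl rfl)
    have hT : T = I.filter (ρ · = ρ t) := by
      ext i
      rw [Finset.mem_filter]
      exact ⟨fun hi => ⟨hTI.1 hi, ((hpq i (hTI.1 hi)).2.2 hi).resolve_left hq⟩,
        fun hi => (hpq i hi.1).2.1 (Or.inr hi.2)⟩
    rcases hq.lt_or_gt with hq | hq
    · right
      have := nonpos_of_mul_nonneg_right (hpq M hM).1 hq
      rw [hT, le_antisymm (hmax t (hTI.1 ht)) (by linarith)]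
    · left
      have := nonneg_of_mul_nonneg_right (hpq m hm).1 hq
      rw [hT, le_antisymm (by linarith) (hmin t (hTI.1 ht))]
  · rintro (rfl | rfl)
    · refine ⟨⟨m, by simp [hm]⟩, Finset.filter_ssubset.2 ⟨M, hM, hmM.symm⟩, -ρ m, 1, ?_⟩
      intro i hi
      have := hmin i hi
      grind
    · refine ⟨⟨M, by simp [hM]⟩, Finset.filter_ssubset.2 ⟨m, hm, hmM⟩, ρ M, -1, ?_⟩
      intro i hi
      have := hmax i hi
      grind

/-- Two functionals form a basis of the dual of the plane, so faces are cut out by affine functions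
of the slope `ψ / φ` of a generator. -/
theorem ncard_isConeFace_of_finrank_eq_two {w : ι → M} {I : Finset ι}
    (hw : finrank 𝕜 (Submodule.span 𝕜 (w '' I)) = 2) {φ : Dual 𝕜 M} (hφ : ∀ i ∈ I, φ (w i) < 0) :
    {T | T.Nonempty ∧ IsConeFace 𝕜 w I T}.ncard = 2 := by
  obtain ⟨i₀, hi₀⟩ : I.Nonempty := by
    rw [Finset.nonempty_iff_ne_empty]
    rintro rfl
    rw [Finset.coe_empty, Set.image_empty, Submodule.span_empty, finrank_bot] at hw
    exact two_ne_zero hw.symm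
  obtain ⟨ψ, hψ, hspan⟩ :=
    exists_dual_eqOn_smul_add_smul hw ⟨w i₀, Set.mem_image_of_mem w hi₀, (hφ i₀ hi₀).ne⟩
  set ρ : ι → 𝕜 := fun i => ψ (w i) / φ (w i)
  have hψρ {i : ι} (hi : i ∈ I) : ψ (w i) = φ (w i) * ρ i := (mul_div_cancel₀ _ (hφ i hi).ne).symm
  have hρ : ∃ i ∈ I, ∃ j ∈ I, ρ i ≠ ρ j := by
    obtain ⟨_, ⟨i, hi, rfl⟩, hne⟩ := hψ (ρ i₀)
    exact ⟨i, hi, i₀, hi₀, fun h => hne (by rw [hψρ hi, h, mul_comm])⟩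
  rw [← ncard_zeroSets_of_affine_nonneg hρ]
  congr 1
  ext T
  refine and_congr_right fun _ => and_congr_right fun _ => ⟨?_, ?_⟩
  · rintro ⟨θ, hθ⟩
    obtain ⟨p, q, hpq⟩ := hspan θ
    refine ⟨p, q, fun i hi => ?_⟩
    have hθi : θ (w i) = φ (w i) * (p + q * ρ i) := by
      rw [hpq _ (Set.mem_image_of_mem w hi), hψρ hi]
      ring
    have := hθ i hi
    rw [hθi, mul_eq_zero, or_iff_right (hφ i hi).ne] at this
    exact ⟨nonneg_of_mul_nonpos_right this.1 (hφ i hi), this.2⟩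
  · rintro ⟨p, q, hpq⟩
    refine ⟨p • φ + q • ψ, fun i hi => ?_⟩
    have hθi : (p • φ + q • ψ) (w i) = φ (w i) * (p + q * ρ i) := by
      simp only [LinearMap.add_apply, LinearMap.smul_apply, smul_eq_mul, hψρ hi]
      ring
    rw [hθi, mul_eq_zero, or_iff_right (hφ i hi).ne]
    exact ⟨mul_nonpos_of_nonpos_of_nonneg (hφ i hi).le (hpq i hi).1, (hpq i hi).2⟩

theorem dual_crossing_nonpos {l θ : Dual 𝕜 M} {u : ι → M} {I : Finset ι}
    (hθ : ∀ i ∈ I, θ (u i) ≤ 0) {p : ι × ι} (hp : p ∈ crossingPairs l u I) :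
    θ (crossing l u p) ≤ 0 ∧
      (θ (crossing l u p) = 0 ↔ θ (u p.1) = 0 ∧ θ (u p.2) = 0) := by
  obtain ⟨⟨hp₁, hp₂⟩, hneg, hpos⟩ := mem_crossingPairs.1 hp
  have h₁ := mul_nonpos_of_nonneg_of_nonpos hpos.le (hθ _ hp₁)
  have h₂ := mul_nonneg_of_nonpos_of_nonpos hneg.le (hθ _ hp₂)
  have heq : θ (crossing l u p) = l (u p.2) * θ (u p.1) - l (u p.1) * θ (u p.2) := by
    simp only [crossing, map_sub, map_smul, smul_eq_mul]
  refine ⟨by linarith, fun h => ⟨?_, ?_⟩, fun h => by simp [heq, h.1, h.2]⟩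
  · exact (mul_eq_zero.1 (show l (u p.2) * θ (u p.1) = 0 by linarith)).resolve_left hpos.ne'
  · exact (mul_eq_zero.1 (show l (u p.1) * θ (u p.2) = 0 by linarith)).resolve_left hneg.ne

theorem isConeFace_crossing {u : ι → M} {I T : Finset ι} {l : Dual 𝕜 M}
    (hl : ∀ i ∈ I, l (u i) = 0 → u i = 0) (hT : IsConeFace 𝕜 u I T)
    (hTne : (crossingPairs l u T).Nonempty) :
    IsConeFace 𝕜 (crossing l u) (crossingPairs l u I) (crossingPairs l u T) := by
  obtain ⟨⟨a, b⟩, hab⟩ := hTne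
  obtain ⟨⟨ha, hb⟩, hla, hlb⟩ := mem_crossingPairs.1 hab
  have hle : crossingPairs l u T ⊆ crossingPairs l u I := fun p hp => by
    rw [mem_crossingPairs] at hp ⊢
    exact ⟨⟨hT.1.1 hp.1.1, hT.1.1 hp.1.2⟩, hp.2⟩
  refine ⟨⟨hle, fun hge => hT.1.2 fun i hi => ?_⟩, ?_⟩
  · rcases lt_trichotomy (l (u i)) 0 with hi₀ | hi₀ | hi₀
    · exact (mem_crossingPairs.1 (@hge (i, b)
        (mem_crossingPairs.2 ⟨⟨hi, hT.1.1 hb⟩, hi₀, hlb⟩))).1.1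
    · exact hT.mem_of_eq_zero hi (hl i hi hi₀)
    · exact (mem_crossingPairs.1 (@hge (a, i)
        (mem_crossingPairs.2 ⟨⟨hT.1.1 ha, hi⟩, hla, hi₀⟩))).1.2
  · obtain ⟨-, θ, hθ⟩ := hT
    refine ⟨θ, fun p hp => ?_⟩
    obtain ⟨hle₀, heq₀⟩ := dual_crossing_nonpos (fun i hi => (hθ i hi).1) hp
    obtain ⟨⟨hp₁, hp₂⟩, hp₀⟩ := mem_crossingPairs.1 hp
    refine ⟨hle₀, ?_⟩
    rw [heq₀, (hθ _ hp₁).2, (hθ _ hp₂).2, mem_crossingPairs, and_iff_left hp₀]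

theorem IsConeFace.exists_crossingPairs_eq {u : ι → M} {I : Finset ι} {l : Dual 𝕜 M}
    (hl : ∀ i ∈ I, l (u i) = 0 → u i = 0) {Q : Finset (ι × ι)}
    (hQ : IsConeFace 𝕜 (crossing l u) (crossingPairs l u I) Q) (hQne : Q.Nonempty) :
    ∃ T, IsConeFace 𝕜 u I T ∧ crossingPairs l u T = Q := by
  obtain ⟨hQI, θ, hθ⟩ := hQ
  obtain ⟨⟨a, b⟩, hab⟩ := hQne
  obtain ⟨⟨ha, hb⟩, hla, hlb⟩ := mem_crossingPairs.1 (hQI.1 hab)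
  obtain ⟨η, hηcrossing, hηa, hηb⟩ :=
    exists_dual_crossing_eq_of_eq_zero hla.ne ((hθ _ (hQI.1 hab)).2.2 hab)
  have hη (i : ι) (hi : i ∈ I) : η (u i) ≤ 0 := by
    rcases lt_trichotomy (l (u i)) 0 with hi₀ | hi₀ | hi₀
    · have := (hθ (i, b) (mem_crossingPairs.2 ⟨⟨hi, hb⟩, hi₀, hlb⟩)).1
      rw [← hηcrossing] at this
      exact nonpos_of_mul_nonpos_right (by simpa [crossing, hηb] using this) hlb
    · rw [hl i hi hi₀, map_zero]
    · have := (hθ (a, i) (mem_crossingPairs.2 ⟨⟨ha, hi⟩, hla, hi₀⟩)).1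
      rw [← hηcrossing] at this
      exact nonpos_of_mul_nonneg_right (by simpa [crossing, hηa] using this) hla
  have hpairs {p : ι × ι} (hp : p ∈ crossingPairs l u I) :
      η (u p.1) = 0 ∧ η (u p.2) = 0 ↔ p ∈ Q := by
    rw [← (dual_crossing_nonpos hη hp).2, hηcrossing, (hθ p hp).2]
  have hT : crossingPairs l u (I.filter fun i => η (u i) = 0) = Q := by
    ext p
    constructor
    · intro hp
      simp only [mem_crossingPairs, Finset.mem_filter] at hp
      exact (hpairs (mem_crossingPairs.2 ⟨⟨hp.1.1.1, hp.1.2.1⟩, hp.2⟩)).1 ⟨hp.1.1.2, hp.1.2.2⟩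
    · intro hp
      have hpη := (hpairs (hQI.1 hp)).2 hp
      have hpI := mem_crossingPairs.1 (hQI.1 hp)
      simp only [mem_crossingPairs, Finset.mem_filter]
      exact ⟨⟨⟨hpI.1.1, hpη.1⟩, hpI.1.2, hpη.2⟩, hpI.2⟩
  refine ⟨_, ⟨(Finset.filter_subset _ _).ssubset_of_ne fun h => hQI.ne ?_, η,
    fun i hi => ⟨hη i hi, ?_⟩⟩, hT⟩
  · rw [← hT, h]
  · rw [Finset.mem_filter, and_iff_right hi]

/-- The section of a three-dimensional cone by a plane through its apex is a two-dimensional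
cone. -/
theorem ncard_isConeFace_crossing {u : ι → M} {I : Finset ι} {l : Dual 𝕜 M}
    (hu : finrank 𝕜 (Submodule.span 𝕜 (u '' I)) = 3) {φ : Dual 𝕜 M}
    (hφ : ∀ i ∈ I, u i ≠ 0 → φ (u i) < 0) (hl : ∀ i ∈ I, l (u i) = 0 → u i = 0)
    (hI : (crossingPairs l u I).Nonempty) :
    {T | IsConeFace 𝕜 u I T ∧ (crossingPairs l u T).Nonempty}.ncard = 2 := by
  have hφcrossing (p : ι × ι) (hp : p ∈ crossingPairs l u I) : φ (crossing l u p) < 0 := by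
    obtain ⟨⟨hp₁, hp₂⟩, hneg, hpos⟩ := mem_crossingPairs.1 hp
    have h₁ := hφ _ hp₁ fun h => hneg.ne (by rw [h, map_zero])
    have h₂ := hφ _ hp₂ fun h => hpos.ne' (by rw [h, map_zero])
    have := mul_neg_of_pos_of_neg hpos h₁
    have := mul_pos_of_neg_of_neg hneg h₂
    simp only [crossing, map_sub, map_smul, smul_eq_mul]
    linarith
  have hinj : Set.InjOn (crossingPairs l u)
      {T | IsConeFace 𝕜 u I T ∧ (crossingPairs l u T).Nonempty} := fun T hT T' hT' h =>
    (hT'.1.subset_of_crossingPairs_subset hl hT.1.1.1 hT.2 h.subset).antisymm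
      (hT.1.subset_of_crossingPairs_subset hl hT'.1.1.1 hT'.2 h.superset)
  rw [← hinj.ncard_image, ← ncard_isConeFace_of_finrank_eq_two
    (Nat.succ_injective ((finrank_span_crossing hl hI).trans hu)) hφcrossing]
  congr 1
  ext Q
  constructor
  · rintro ⟨T, ⟨hT, hTne⟩, rfl⟩
    exact ⟨hTne, isConeFace_crossing hl hT hTne⟩
  · rintro ⟨hQne, hQ⟩
    obtain ⟨T, hT, rfl⟩ := hQ.exists_crossingPairs_eq hl hQne
    exact ⟨T, ⟨hT, hQne⟩, rfl⟩

end ConeFaces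

/-! ### Faces of finite point configurations -/

section FaceSets

open Module

variable {𝕜 E : Type*} [Field 𝕜] [LinearOrder 𝕜] [AddCommGroup E] [Module 𝕜 E]

/-- `σ` is the set of points of `V` lying on a proper, possibly empty, face of the convex hull of
`V`. -/
def IsFaceSet (𝕜 : Type*) {E : Type*} [Field 𝕜] [LinearOrder 𝕜] [AddCommGroup E] [Module 𝕜 E]
    (V σ : Finset E) : Prop :=
  σ ⊂ V ∧ ∃ (θ : Dual 𝕜 E) (c : 𝕜), ∀ x ∈ V, θ x ≤ c ∧ (θ x = c ↔ x ∈ σ)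

/-- The points of `S` at which `l` attains neither its minimum nor its maximum over `S`. -/
noncomputable def middlePoints (l : Dual 𝕜 E) (S : Finset E) : Finset E :=
  S.filter fun v => (∃ a ∈ S, l a < l v) ∧ ∃ b ∈ S, l v < l b

theorem mem_middlePoints {l : Dual 𝕜 E} {S : Finset E} {v : E} :
    v ∈ middlePoints l S ↔ v ∈ S ∧ (∃ a ∈ S, l a < l v) ∧ ∃ b ∈ S, l v < l b :=
  Finset.mem_filter

theorem middlePoints_subset {l : Dual 𝕜 E} {S : Finset E} : middlePoints l S ⊆ S :=
  Finset.filter_subset _ _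

theorem middlePoints_mono {l : Dual 𝕜 E} {S T : Finset E} (h : S ⊆ T) :
    middlePoints l S ⊆ middlePoints l T := by
  intro v hv
  obtain ⟨hvS, ⟨a, ha, hav⟩, b, hb, hvb⟩ := mem_middlePoints.1 hv
  exact mem_middlePoints.2 ⟨h hvS, ⟨a, h ha, hav⟩, b, h hb, hvb⟩

theorem card_middlePoints_add_two {l : Dual 𝕜 E} {S : Finset E} (hl : Set.InjOn l S)
    (hS : 2 ≤ S.card) : (middlePoints l S).card + 2 = S.card := by
  classical
  have hne : S.Nonempty := Finset.card_pos.1 (by lia)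
  obtain ⟨m, hm, hmin⟩ := S.exists_min_image l hne
  obtain ⟨M, hM, hmax⟩ := S.exists_max_image l hne
  have hmM : M ≠ m := by
    rintro rfl
    obtain ⟨x, hx, y, hy, hxy⟩ := Finset.one_lt_card.1 hS
    exact hxy (hl hx hy (((hmax x hx).antisymm (hmin x hx)).trans
      ((hmin y hy).antisymm (hmax y hy))))
  have : middlePoints l S = (S.erase m).erase M := by
    ext v
    simp only [mem_middlePoints, Finset.mem_erase]
    constructor
    · rintro ⟨hv, ⟨a, ha, hav⟩, b, hb, hvb⟩
      refine ⟨?_, ?_, hv⟩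
      · rintro rfl
        exact (hmax b hb).not_gt hvb
      · rintro rfl
        exact (hmin a ha).not_gt hav
    · rintro ⟨hvM, hvm, hv⟩
      exact ⟨hv, ⟨m, hm, (hmin v hv).lt_of_ne fun h => hvm (hl hv hm h.symm)⟩,
        M, hM, (hmax v hv).lt_of_ne fun h => hvM (hl hv hM h)⟩
  rw [this, Finset.card_erase_of_mem (Finset.mem_erase.2 ⟨hmM, hM⟩), Finset.card_erase_of_mem hm]
  lia

variable {V σ τ : Finset E} {a : E}

open Classical in
/-- The faces of the configuration `V` that contain exactly `r` of its points. -/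
noncomputable def facesOfCard (𝕜 : Type*) {E : Type*} [Field 𝕜] [LinearOrder 𝕜] [AddCommGroup E]
    [Module 𝕜 E] (V : Finset E) (r : ℕ) : Finset (Finset E) :=
  {σ ∈ V.powersetCard r | IsFaceSet 𝕜 V σ}

theorem mem_facesOfCard {r : ℕ} : σ ∈ facesOfCard 𝕜 V r ↔ IsFaceSet 𝕜 V σ ∧ σ.card = r := by
  classical
  rw [facesOfCard, Finset.mem_filter, Finset.mem_powersetCard]
  exact ⟨fun h => ⟨h.2, h.1.2⟩, fun h => ⟨⟨h.1.1.1, h.2⟩, h.1⟩⟩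

variable [IsStrictOrderedRing 𝕜]

theorem isFaceSet_iff_isConeFace_sub (ha : a ∈ σ) :
    IsFaceSet 𝕜 V σ ↔ IsConeFace 𝕜 (· - a) V σ := by
  refine and_congr_right fun hσV => exists_congr fun θ => ?_
  simp only [map_sub, sub_nonpos, sub_eq_zero]
  refine ⟨?_, fun h => ⟨θ a, h⟩⟩
  rintro ⟨c, hθ⟩
  rwa [(hθ a (hσV.1 ha)).2.2 ha]

theorem IsFaceSet.trans (hσ : IsFaceSet 𝕜 V σ) (hτ : IsFaceSet 𝕜 σ τ) : IsFaceSet 𝕜 V τ := by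
  obtain ⟨hσV, θ, c, hθ⟩ := hσ
  obtain ⟨hτσ, χ, d, hχ⟩ := hτ
  obtain ⟨N, hN⟩ := (V.image fun x => (χ x - d) / (c - θ x)).exists_le
  refine ⟨hτσ.trans hσV, (N + 1) • θ + χ, (N + 1) * c + d, fun x hx => ?_⟩
  simp only [LinearMap.add_apply, LinearMap.smul_apply, smul_eq_mul]
  by_cases hxσ : x ∈ σ
  · rw [(hθ x hx).2.2 hxσ, add_le_add_iff_left, add_right_inj]
    exact hχ x hxσ
  · have hθx : 0 < c - θ x := sub_pos.2 ((hθ x hx).1.lt_of_ne fun h => hxσ ((hθ x hx).2.1 h))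
    have hNx := hN _ (Finset.mem_image_of_mem _ hx)
    rw [div_le_iff₀ hθx] at hNx
    have hlt : (N + 1) * θ x + χ x < (N + 1) * c + d := by linarith
    exact ⟨hlt.le, iff_of_false hlt.ne fun h => hxσ (hτσ.1 h)⟩

theorem isFaceSet_of_ssubset_of_affineIndependent
    (hσ : AffineIndependent 𝕜 (fun x : σ => (x : E))) (hτσ : τ ⊂ σ) : IsFaceSet 𝕜 σ τ := by
  classical
  rcases τ.eq_empty_or_nonempty with rfl | ⟨a, ha⟩
  · exact ⟨hτσ, 0, 1, fun x _ => by simp⟩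
  · rw [isFaceSet_iff_isConeFace_sub ha]
    rw [affineIndependent_iff_linearIndependent_vsub 𝕜 _ ⟨a, hτσ.1 ha⟩] at hσ
    obtain ⟨θ, hθ⟩ := exists_dual_eq_of_linearIndependent hσ
      fun x => if (x : σ).1 ∈ τ then (0 : 𝕜) else -1
    refine ⟨hτσ, θ, fun x hx => ?_⟩
    by_cases hxa : x = a
    · simp [hxa, ha]
    · have : θ (x - a) = if x ∈ τ then 0 else -1 :=
        hθ ⟨⟨x, hx⟩, fun h => hxa (congrArg Subtype.val h)⟩
      rw [this]
      split_ifs with hxτ <;> simp [hxτ]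

theorem IsFaceSet.of_subset_of_affineIndependent (hσ : IsFaceSet 𝕜 V σ)
    (hind : AffineIndependent 𝕜 (fun x : σ => (x : E))) (hτσ : τ ⊆ σ) : IsFaceSet 𝕜 V τ := by
  rcases hτσ.eq_or_ssubset with rfl | hτσ
  · exact hσ
  · exact hσ.trans (isFaceSet_of_ssubset_of_affineIndependent hind hτσ)

theorem IsFaceSet.finrank_vectorSpan_lt (hσ : IsFaceSet 𝕜 V σ) (hne : σ.Nonempty) :
    finrank 𝕜 (vectorSpan 𝕜 (σ : Set E)) < finrank 𝕜 (vectorSpan 𝕜 (V : Set E)) := by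
  obtain ⟨a, ha⟩ := hne
  obtain ⟨hσV, θ, hθ⟩ := (isFaceSet_iff_isConeFace_sub ha).1 hσ
  obtain ⟨x, hx, hxσ⟩ := Finset.exists_of_ssubset hσV
  have : FiniteDimensional 𝕜 (vectorSpan 𝕜 (V : Set E)) :=
    finiteDimensional_vectorSpan_of_finite 𝕜 V.finite_toSet
  have hker := vectorSpan_le_ker (S := σ) fun y hy => (hθ y (hσV.1 hy)).2.2 hy
  refine Submodule.finrank_lt_finrank_of_lt (SetLike.lt_iff_le_and_exists.2
    ⟨vectorSpan_mono 𝕜 (by exact_mod_cast hσV.1), x - a, ?_, fun h => hxσ ((hθ x hx).2.1 (hker h))⟩)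
  exact vsub_mem_vectorSpan 𝕜 hx (hσV.1 ha)

theorem IsFaceSet.card_le_finrank_vectorSpan (hσ : IsFaceSet 𝕜 V σ)
    (hind : AffineIndependent 𝕜 (fun x : σ => (x : E))) :
    σ.card ≤ finrank 𝕜 (vectorSpan 𝕜 (V : Set E)) := by
  rcases σ.eq_empty_or_nonempty with rfl | hne
  · simp
  · rw [← finrank_vectorSpan_add_one_of_affineIndependent hind hne]
    exact hσ.finrank_vectorSpan_lt hne

theorem isFaceSet_iff_isConeFace_mkQ [DecidableEq E] (hσV : σ ⊆ V) (ha : a ∈ σ) (hστ : σ ⊆ τ) :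
    IsFaceSet 𝕜 V τ ↔
      IsConeFace 𝕜 (fun x => (vectorSpan 𝕜 (σ : Set E)).mkQ (x - a)) (V \ σ) (τ \ σ) := by
  rw [isFaceSet_iff_isConeFace_sub (hστ ha)]
  constructor
  · rintro ⟨hτV, θ, hθ⟩
    have hker : vectorSpan 𝕜 (σ : Set E) ≤ LinearMap.ker θ :=
      vectorSpan_le_ker fun x hx => (hθ x (hσV hx)).2.2 (hστ hx)
    refine ⟨⟨Finset.sdiff_subset_sdiff hτV.1 subset_rfl, fun h => hτV.2 fun x hx => ?_⟩,
      (vectorSpan 𝕜 (σ : Set E)).liftQ θ hker, fun x hx => ?_⟩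
    · by_cases hxσ : x ∈ σ
      · exact hστ hxσ
      · exact (Finset.mem_sdiff.1 (h (Finset.mem_sdiff.2 ⟨hx, hxσ⟩))).1
    · rw [Finset.mem_sdiff] at hx
      simp only [Submodule.mkQ_apply, Submodule.liftQ_apply, Finset.mem_sdiff, and_iff_left hx.2]
      exact hθ x hx.1
  · rintro ⟨hT, θ, hθ⟩
    refine ⟨⟨fun x hx => ?_, fun h => hT.2 (Finset.sdiff_subset_sdiff h subset_rfl)⟩,
      θ ∘ₗ (vectorSpan 𝕜 (σ : Set E)).mkQ, fun x hx => ?_⟩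
    · by_cases hxσ : x ∈ σ
      · exact hσV hxσ
      · exact (Finset.mem_sdiff.1 (hT.1 (Finset.mem_sdiff.2 ⟨hx, hxσ⟩))).1
    · rw [LinearMap.comp_apply]
      by_cases hxσ : x ∈ σ
      · rw [mkQ_vectorSpan_sub_eq_zero hxσ ha, map_zero]
        exact ⟨le_rfl, iff_of_true rfl (hστ hxσ)⟩
      · have := hθ x (Finset.mem_sdiff.2 ⟨hx, hxσ⟩)
        rwa [Finset.mem_sdiff, and_iff_left hxσ] at this

/-- Modulo the direction of `σ`, the points of `V` generate a pointed two-dimensional cone. -/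
theorem IsFaceSet.ncard_isFaceSet_ssuperset (hσ : IsFaceSet 𝕜 V σ) (hne : σ.Nonempty)
    (hrank : finrank 𝕜 (vectorSpan 𝕜 (V : Set E)) = finrank 𝕜 (vectorSpan 𝕜 (σ : Set E)) + 2) :
    {τ | σ ⊂ τ ∧ IsFaceSet 𝕜 V τ}.ncard = 2 := by
  classical
  obtain ⟨a, ha⟩ := hne
  obtain ⟨-, φ, hφ⟩ := (isFaceSet_iff_isConeFace_mkQ hσ.1.1 ha subset_rfl).1 hσ
  have hφneg (x : E) (hx : x ∈ V \ σ) : φ ((vectorSpan 𝕜 (σ : Set E)).mkQ (x - a)) < 0 :=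
    (hφ x hx).1.lt_of_ne fun h => by simpa using (hφ x hx).2.1 h
  have hinj : Set.InjOn (· \ σ) {τ | σ ⊂ τ ∧ IsFaceSet 𝕜 V τ} := fun τ hτ τ' hτ' h => by
    rw [← Finset.sdiff_union_of_subset hτ.1.1, ← Finset.sdiff_union_of_subset hτ'.1.1]
    exact congrArg (· ∪ σ) h
  have hdim := finrank_span_mkQ_add_finrank (K := 𝕜) hσ.1.1 ha
  rw [← hinj.ncard_image, ← ncard_isConeFace_of_finrank_eq_two (by lia) hφneg]
  congr 1
  ext T
  constructor
  · rintro ⟨τ, ⟨hστ, hτ⟩, rfl⟩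
    exact ⟨Finset.sdiff_nonempty.2 hστ.2, (isFaceSet_iff_isConeFace_mkQ hσ.1.1 ha hστ.1).1 hτ⟩
  · rintro ⟨hTne, hT⟩
    have hdisj : Disjoint T σ := Finset.sdiff_disjoint.mono_left hT.1.1
    have hT' : (T ∪ σ) \ σ = T := Finset.union_sdiff_cancel_right hdisj
    refine ⟨T ∪ σ, ⟨⟨Finset.subset_union_right, fun h => ?_⟩, ?_⟩, hT'⟩
    · rw [← Finset.sdiff_eq_empty_iff_subset, hT'] at h
      exact hTne.ne_empty h
    · rwa [isFaceSet_iff_isConeFace_mkQ hσ.1.1 ha Finset.subset_union_right, hT']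

theorem mem_middlePoints_iff_crossingPairs {l : Dual 𝕜 E} {S : Finset E} {v : E} (hv : v ∈ S) :
    v ∈ middlePoints l S ↔ (crossingPairs l (· - v) S).Nonempty := by
  simp only [mem_middlePoints, and_iff_right hv, Finset.Nonempty, mem_crossingPairs, Prod.exists,
    map_sub, sub_neg, sub_pos]
  exact ⟨fun ⟨⟨a, ha, hav⟩, b, hb, hvb⟩ => ⟨a, b, ⟨ha, hb⟩, hav, hvb⟩,
    fun ⟨a, b, ⟨ha, hb⟩, hav, hvb⟩ => ⟨⟨a, ha, hav⟩, b, hb, hvb⟩⟩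

/-- These faces correspond to the proper faces, other than the apex, of the section of the cone of
`V` at `v` by the plane `l = 0`. -/
theorem IsFaceSet.ncard_isFaceSet_middlePoints {v : E} (hv : IsFaceSet 𝕜 V {v})
    (hrank : finrank 𝕜 (vectorSpan 𝕜 (V : Set E)) = 3) {l : Dual 𝕜 E} (hl : Set.InjOn l V)
    (hvl : v ∈ middlePoints l V) :
    {τ | IsFaceSet 𝕜 V τ ∧ v ∈ middlePoints l τ}.ncard = 2 := by
  have hvV := middlePoints_subset hvl
  obtain ⟨-, φ, hφ⟩ := (isFaceSet_iff_isConeFace_sub (Finset.mem_singleton_self v)).1 hv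
  have hφneg (x : E) (hx : x ∈ V) (hxv : x - v ≠ 0) : φ (x - v) < 0 :=
    (hφ x hx).1.lt_of_ne fun h =>
      sub_ne_zero.1 hxv (Finset.mem_singleton.1 ((hφ x hx).2.1 h))
  have hlv (x : E) (hx : x ∈ V) (h : l (x - v) = 0) : x - v = 0 := by
    rw [map_sub, sub_eq_zero] at h
    exact sub_eq_zero.2 (hl hx hvV h)
  rw [← ncard_isConeFace_crossing
    (by rw [← hrank, vectorSpan_eq_span_vsub_set_right 𝕜 (Finset.mem_coe.2 hvV)]; rfl) hφneg hlv
    ((mem_middlePoints_iff_crossingPairs hvV).1 hvl)]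
  congr 1
  ext τ
  constructor
  · rintro ⟨hτ, hvτ⟩
    have hv := middlePoints_subset hvτ
    exact ⟨(isFaceSet_iff_isConeFace_sub hv).1 hτ, (mem_middlePoints_iff_crossingPairs hv).1 hvτ⟩
  · rintro ⟨hτ, hvτ⟩
    have hv := hτ.mem_of_eq_zero hvV (sub_self v)
    exact ⟨(isFaceSet_iff_isConeFace_sub hv).2 hτ, (mem_middlePoints_iff_crossingPairs hv).2 hvτ⟩

/-- The points of `V` are the vertices of their convex hull, and every proper face of the convex
hull is a simplex. -/
structure IsSimplicialConfiguration (𝕜 : Type*) {E : Type*} [Field 𝕜] [LinearOrder 𝕜]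
    [AddCommGroup E] [Module 𝕜 E] (V : Finset E) : Prop where
  affineIndependent {σ : Finset E} (hσ : IsFaceSet 𝕜 V σ) :
    AffineIndependent 𝕜 fun x : σ => (x : E)
  isFaceSet_singleton {v : E} (hv : v ∈ V) : IsFaceSet 𝕜 V {v}

namespace IsSimplicialConfiguration

theorem isFaceSet_of_subset (hV : IsSimplicialConfiguration 𝕜 V) (hσ : IsFaceSet 𝕜 V σ)
    (hτσ : τ ⊆ σ) : IsFaceSet 𝕜 V τ :=
  hσ.of_subset_of_affineIndependent (hV.affineIndependent hσ) hτσ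

theorem card_facesOfCard_three_add_four (hV : IsSimplicialConfiguration 𝕜 V)
    (hrank : finrank 𝕜 (vectorSpan 𝕜 (V : Set E)) = 3) :
    (facesOfCard 𝕜 V 3).card + 4 = 2 * V.card := by
  classical
  obtain ⟨l, hl⟩ := exists_dual_injOn (K := 𝕜) V
  have hcard := finrank_vectorSpan_lt_card (K := 𝕜) (hrank ▸ three_pos)
  have hcount := Finset.card_mul_eq_card_mul (fun σ v => v ∈ middlePoints l σ)
    (s := facesOfCard 𝕜 V 3) (t := middlePoints l V) (m := 1) (n := 2)
    (fun σ hσ => ?_) (fun v hv => ?_)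
  · have := card_middlePoints_add_two hl (by lia)
    lia
  · obtain ⟨hσ, hσ3⟩ := mem_facesOfCard.1 hσ
    rw [Finset.bipartiteAbove, Finset.filter_mem_eq_inter,
      Finset.inter_eq_right.2 (middlePoints_mono hσ.1.1)]
    have := card_middlePoints_add_two (hl.mono (Finset.coe_subset.2 hσ.1.1)) (by lia : 2 ≤ σ.card)
    lia
  · rw [← (hV.isFaceSet_singleton (middlePoints_subset hv)).ncard_isFaceSet_middlePoints
      hrank hl hv, ← Set.ncard_coe_finset]
    congr 1
    ext τ
    rw [Finset.mem_coe, Finset.mem_bipartiteBelow, mem_facesOfCard]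
    refine ⟨fun h => ⟨h.1.1, h.2⟩, fun ⟨hτ, hvτ⟩ => ⟨⟨hτ, ?_⟩, hvτ⟩⟩
    obtain ⟨hvmem, ⟨a, ha, hav⟩, b, hb, hvb⟩ := mem_middlePoints.1 hvτ
    refine le_antisymm (hrank ▸ hτ.card_le_finrank_vectorSpan (hV.affineIndependent hτ)) ?_
    exact Finset.two_lt_card.2 ⟨a, ha, v, hvmem, b, hb, ne_of_apply_ne l hav.ne,
      ne_of_apply_ne l (hav.trans hvb).ne, ne_of_apply_ne l hvb.ne⟩

theorem three_mul_card_facesOfCard_three (hV : IsSimplicialConfiguration 𝕜 V)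
    (hrank : finrank 𝕜 (vectorSpan 𝕜 (V : Set E)) = 3) :
    3 * (facesOfCard 𝕜 V 3).card = 2 * (facesOfCard 𝕜 V 2).card := by
  classical
  rw [mul_comm 3, mul_comm 2]
  refine Finset.card_mul_eq_card_mul (fun σ e => e ⊆ σ) (fun σ hσ => ?_) (fun e he => ?_)
  · obtain ⟨hσ, hσ3⟩ := mem_facesOfCard.1 hσ
    have hedges : Finset.bipartiteAbove (fun σ e => e ⊆ σ) (facesOfCard 𝕜 V 2) σ =
        σ.powersetCard 2 := by
      ext e
      rw [Finset.mem_bipartiteAbove, mem_facesOfCard, Finset.mem_powersetCard]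
      exact ⟨fun h => ⟨h.2, h.1.2⟩, fun h => ⟨⟨hV.isFaceSet_of_subset hσ h.1, h.2⟩, h.1⟩⟩
    rw [hedges, Finset.card_powersetCard, hσ3]
    rfl
  · obtain ⟨he, he2⟩ := mem_facesOfCard.1 he
    have hne : e.Nonempty := Finset.card_pos.1 (by lia)
    have hrank_e := finrank_vectorSpan_add_one_of_affineIndependent (hV.affineIndependent he) hne
    rw [← he.ncard_isFaceSet_ssuperset hne (by lia), ← Set.ncard_coe_finset]
    congr 1
    ext τ
    rw [Finset.mem_coe, Finset.mem_bipartiteBelow, mem_facesOfCard]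
    constructor
    · rintro ⟨⟨hτ, hτ3⟩, heτ⟩
      exact ⟨heτ.ssubset_of_ne (by rintro rfl; lia), hτ⟩
    · rintro ⟨heτ, hτ⟩
      have hlt := Finset.card_lt_card heτ
      have hle := hτ.card_le_finrank_vectorSpan (hV.affineIndependent hτ)
      exact ⟨⟨hτ, by lia⟩, heτ.1⟩

theorem card_facesOfCard_two_add_six (hV : IsSimplicialConfiguration 𝕜 V)
    (hrank : finrank 𝕜 (vectorSpan 𝕜 (V : Set E)) = 3) :
    (facesOfCard 𝕜 V 2).card + 6 = 3 * V.card := by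
  have := hV.card_facesOfCard_three_add_four hrank
  have := hV.three_mul_card_facesOfCard_three hrank
  lia

end IsSimplicialConfiguration

end FaceSets

/-! ### Homology in low degrees -/

namespace SimplicialHomology

open Module

variable {α : Type*} (k : Type*) [Field k] {K : Set (Set α)}

theorem finrank_subquotient_eq_zero {M : Type*} [AddCommGroup M] [Module k M]
    {Z B : Submodule k M} (h : Z ≤ B) : finrank k (Subquotient k Z B) = 0 := by
  have := Submodule.Quotient.subsingleton_iff.2 (Submodule.comap_subtype_eq_top.2 h)
  exact finrank_zero_of_subsingleton

theorem finrank_subquotient_bot {M : Type*} [AddCommGroup M] [Module k M] (Z : Submodule k M) :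
    finrank k (Subquotient k Z ⊥) = finrank k Z :=
  (Submodule.quotEquivOfEqBot _ (by rw [Submodule.comap_bot, Submodule.ker_subtype])).finrank_eq

theorem cone_mem_chains {a : α} (hK : ∀ F ∈ K, insert a F ∈ K) {d : ℤ} {c : List α →₀ k}
    (hc : c ∈ chains k K d) : cone k a c ∈ chains k K (d + 1) := by
  have hcone := Submodule.mem_map_of_mem (f := cone k a) hc
  rw [chains, cone, Finsupp.lmapDomain_supported] at hcone
  refine Finsupp.supported_mono ?_ hcone
  rintro _ ⟨t, ⟨htd, htK⟩, rfl⟩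
  refine ⟨by rw [List.length_cons, Nat.cast_add_one, htd], ?_⟩
  convert hK _ htK using 1
  ext v
  exact List.mem_cons

theorem finrank_reducedHomology_eq_zero_of_insert_mem {a : α} (hK : ∀ F ∈ K, insert a F ∈ K)
    (d : ℤ) : finrank k (ReducedHomology k K d) = 0 := by
  refine finrank_subquotient_eq_zero k fun c hc => ⟨cone k a c, cone_mem_chains k hK hc.1, ?_⟩
  rw [boundary_cone, LinearMap.mem_ker.1 hc.2, map_zero, sub_zero]

theorem boundaries_zero_eq_bot (hK : ∀ F ∈ K, F.Subsingleton) : boundaries k K 0 = ⊥ := by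
  rw [boundaries, chains, Finsupp.supported_eq_span_single, Submodule.map_span,
    Submodule.span_eq_bot]
  rintro _ ⟨_, ⟨t, ⟨ht, htK⟩, rfl⟩, rfl⟩
  obtain ⟨x, y, rfl⟩ := List.length_eq_two.1 (by exact_mod_cast ht : t.length = 2)
  obtain rfl : x = y := hK _ htK (x := x) (y := y) (by simp) (by simp)
  simp [boundary_single, Finset.sum_range_succ]

theorem chains_zero {V : Finset α} (hV : ∀ v, {v} ∈ K ↔ v ∈ V) :
    chains k K 0 = Finsupp.supported k k ((fun v => [v]) '' (V : Set α)) := by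
  rw [chains]
  congr 1
  ext t
  have hmem (v : α) : {w | w ∈ [v]} ∈ K ↔ v ∈ V := by simp [← hV]
  constructor
  · rintro ⟨htd, htK⟩
    obtain ⟨v, rfl⟩ := List.length_eq_one_iff.1 (by exact_mod_cast htd : t.length = 1)
    exact ⟨v, (hmem v).1 htK, rfl⟩
  · rintro ⟨v, hv, rfl⟩
    exact ⟨rfl, (hmem v).2 hv⟩

theorem finrank_chains_zero {V : Finset α} (hV : ∀ v, {v} ∈ K ↔ v ∈ V) :
    finrank k (chains k K 0) = V.card := by
  classical
  rw [chains_zero k hV, (Finsupp.supportedEquivFinsupp _).finrank_eq, ← Finset.coe_image,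
    finrank_finsupp_self, ← Nat.card_eq_fintype_card, Nat.card_coe_set_eq, Set.ncard_coe_finset,
    Finset.card_image_of_injective _ List.singleton_injective]

theorem map_boundary_chains_zero {V : Finset α} (hV : ∀ v, {v} ∈ K ↔ v ∈ V) (hne : V.Nonempty) :
    (chains k K 0).map (boundary k) = Submodule.span k {Finsupp.single [] 1} := by
  rw [chains_zero k hV, Finsupp.supported_eq_span_single, Submodule.map_span, Set.image_image,
    Set.image_image]
  simp only [boundary_single, List.length_singleton, Finset.range_one, Finset.sum_singleton,
    List.eraseIdx_zero, List.tail_cons, pow_zero]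
  rw [Set.Nonempty.image_const (Finset.coe_nonempty.2 hne)]

theorem finrank_reducedHomology_zero_add_one (hK : ∀ F ∈ K, F.Subsingleton) {V : Finset α}
    (hV : ∀ v, {v} ∈ K ↔ v ∈ V) (hne : V.Nonempty) :
    finrank k (ReducedHomology k K 0) + 1 = V.card := by
  have : FiniteDimensional k (chains k K 0) :=
    .of_finrank_pos (by rw [finrank_chains_zero k hV]; exact hne.card_pos)
  unfold ReducedHomology
  rw [boundaries_zero_eq_bot k hK, finrank_subquotient_bot, cycles, add_comm,
    ← finrank_chains_zero k hV, ← finrank_map_add_finrank_inf_ker (boundary k) (chains k K 0),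
    map_boundary_chains_zero k hV hne, finrank_span_singleton (by simp)]

end SimplicialHomology

/-! ### Exposed faces of polytopes -/

section ExposedFaces

variable {E : Type*} [AddCommGroup E] [Module ℝ E] [TopologicalSpace E]

theorem isExposed_iff_exists_forall_le {A F : Set E} : IsExposed ℝ A F ↔
    F ⊆ A ∧ ∃ (l : StrongDual ℝ E) (c : ℝ), ∀ x ∈ A, l x ≤ c ∧ (l x = c ↔ x ∈ F) := by
  constructor
  · refine fun h => ⟨h.subset, ?_⟩
    rcases F.eq_empty_or_nonempty with rfl | ⟨p, hp⟩
    · exact ⟨0, 1, fun x _ => by simp⟩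
    obtain ⟨l, rfl⟩ := h ⟨p, hp⟩
    refine ⟨l, l p, fun x hx => ⟨hp.2 x hx, fun hxp => ⟨hx, fun y hy => hxp ▸ hp.2 y hy⟩, ?_⟩⟩
    exact fun hxF => (hp.2 x hx).antisymm (hxF.2 p hp.1)
  · rintro ⟨hFA, l, c, hl⟩ ⟨p, hp⟩
    refine ⟨l, Set.ext fun x => ⟨fun hx => ⟨hFA hx, fun y hy => ?_⟩, fun ⟨hx, hmax⟩ => ?_⟩⟩
    · rw [(hl x (hFA hx)).2.2 hx]
      exact (hl y hy).1
    · have hpx := hmax p (hFA hp)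
      rw [(hl p (hFA hp)).2.2 hp] at hpx
      exact (hl x hx).2.1 ((hl x hx).1.antisymm hpx)

theorem le_and_eq_iff_of_mem_convexHull_insert {T : Set E} {x y : E} {l : StrongDual ℝ E}
    (hl : ∀ t ∈ T, l t < l x) (hy : y ∈ convexHull ℝ (insert x T)) :
    l y ≤ l x ∧ (l y = l x ↔ y = x) := by
  suffices h : y = x ∨ l y < l x by
    rcases h with rfl | h
    · exact ⟨le_rfl, iff_of_true rfl rfl⟩
    · exact ⟨h.le, iff_of_false h.ne (ne_of_apply_ne l h.ne)⟩
  rcases T.eq_empty_or_nonempty with rfl | hne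
  · left
    rwa [insert_empty_eq, convexHull_singleton] at hy
  rw [convexHull_insert hne, convexJoin_singleton_left, Set.mem_iUnion₂] at hy
  obtain ⟨z, hz, hyz⟩ := hy
  have hzx : l z < l x := convexHull_min hl (convex_halfSpace_lt l.isLinear (l x)) hz
  rw [segment_eq_image_lineMap] at hyz
  obtain ⟨q, ⟨hq, -⟩, rfl⟩ := hyz
  rcases hq.eq_or_lt with rfl | hq
  · left
    exact AffineMap.lineMap_apply_zero x z
  · right
    rw [AffineMap.lineMap_apply, vsub_eq_sub, vadd_eq_add, map_add, map_smul, map_sub]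
    exact add_lt_of_neg_left _ (mul_neg_of_pos_of_neg hq (sub_neg.2 hzx))

variable [T2Space E] [IsTopologicalAddGroup E] [ContinuousSMul ℝ E] [LocallyConvexSpace ℝ E]

theorem convexHull_extremePoints_convexHull {S : Set E} (hS : S.Finite) :
    convexHull ℝ ((convexHull ℝ S).extremePoints ℝ) = convexHull ℝ S := by
  have hclosed := (hS.subset (extremePoints_convexHull_subset (𝕜 := ℝ))).isClosed_convexHull
    (𝕜 := ℝ)
  rw [← hclosed.closure_eq, closure_convexHull_extremePoints (hS.isCompact_convexHull ℝ)
    (convex_convexHull ℝ S)]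

theorem exposedPoints_convexHull {S : Set E} (hS : S.Finite) :
    (convexHull ℝ S).exposedPoints ℝ = (convexHull ℝ S).extremePoints ℝ := by
  refine exposedPoints_subset_extremePoints.antisymm fun x hx => ?_
  set T := (convexHull ℝ S).extremePoints ℝ \ {x}
  have hxT : x ∉ convexHull ℝ T := fun h =>
    ((convex_convexHull ℝ S).mem_extremePoints_iff_mem_sdiff_convexHull_sdiff.1 hx).2
      (convexHull_mono (Set.sdiff_subset_sdiff_left extremePoints_subset) h)
  have hTfin : T.Finite := (hS.subset extremePoints_convexHull_subset).subset Set.sdiff_subset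
  obtain ⟨l, u, hlu, hux⟩ := geometric_hahn_banach_closed_point (convex_convexHull ℝ T)
    (hTfin.isClosed_convexHull ℝ) hxT
  have hl (t : E) (ht : t ∈ T) : l t < l x := (hlu t (subset_convexHull ℝ T ht)).trans hux
  refine mem_exposedPoints_iff_exposed_singleton.2 (isExposed_iff_exists_forall_le.2
    ⟨Set.singleton_subset_iff.2 hx.1, l, l x, fun y hy => ?_⟩)
  rw [← convexHull_extremePoints_convexHull hS, ← Set.insert_sdiff_self_of_mem hx] at hy
  exact le_and_eq_iff_of_mem_convexHull_insert hl hy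

theorem exists_strongDual_eqOn (V : Finset E) (θ : Module.Dual ℝ E) :
    ∃ l : StrongDual ℝ E, Set.EqOn l θ V := by
  obtain ⟨l, hl⟩ := (SeparatingDual.dualMap_surjective_iff (R := ℝ)
    (f := (Submodule.span ℝ (V : Set E)).subtype)).2 (Submodule.subtype_injective _)
      (θ.domRestrict _)
  exact ⟨l, fun x hx => LinearMap.congr_fun hl ⟨x, Submodule.subset_span hx⟩⟩

end ExposedFaces

namespace ConvexPolytope

variable {E : Type*} [AddCommGroup E] [Module ℝ E] [TopologicalSpace E] {P : ConvexPolytope E}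

theorem mem_vertices {v : E} : v ∈ P.vertices ↔ v ∈ P.carrier.exposedPoints ℝ :=
  Set.Finite.mem_toFinset _

theorem coe_vertices_subset_carrier : (P.vertices : Set E) ⊆ P.carrier :=
  fun _ hv => (mem_vertices.1 hv).1

theorem subset_of_isProperFace_of_coe_eq_inter {F : Set E} {σ S : Finset E} (hF : P.IsProperFace F)
    (hσ : (σ : Set E) = F ∩ P.vertices) (hS : F = convexHull ℝ (S : Set E)) : σ ⊆ S := by
  intro x hx
  rw [← Finset.mem_coe, hσ] at hx
  have hxF : x ∈ F.extremePoints ℝ := inter_extremePoints_subset_extremePoints_of_subset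
    hF.1.subset ⟨hx.1, exposedPoints_subset_extremePoints (mem_vertices.1 hx.2)⟩
  rw [hS] at hxF
  exact extremePoints_convexHull_subset hxF

theorem finite_of_mem_boundaryComplex {F : Set E} (hF : F ∈ P.boundaryComplex) : F.Finite := by
  obtain ⟨F, -, rfl⟩ := hF
  exact P.vertices.finite_toSet.inter_of_right F

theorem finite_of_mem_restrictComplex {W : Finset E} {F : Set E}
    (hF : F ∈ restrictComplex P.boundaryComplex W) : F.Finite := by
  obtain ⟨F, -, rfl⟩ := hF
  exact W.finite_toSet.inter_of_right F

variable [T2Space E] [IsTopologicalAddGroup E] [ContinuousSMul ℝ E] [LocallyConvexSpace ℝ E]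

theorem convexHull_vertices (P : ConvexPolytope E) :
    convexHull ℝ (P.vertices : Set E) = P.carrier := by
  obtain ⟨S, hS⟩ := P.exists_eq_convexHull
  rw [vertices, Set.Finite.coe_toFinset, hS, exposedPoints_convexHull S.finite_toSet,
    convexHull_extremePoints_convexHull S.finite_toSet]

theorem finrank_vectorSpan_vertices (P : ConvexPolytope E) :
    Module.finrank ℝ (vectorSpan ℝ (P.vertices : Set E)) = P.dim := by
  rw [dim, ← P.convexHull_vertices, affineSpan_convexHull, direction_affineSpan]

theorem isFaceSet_of_isProperFace {F : Set E} {σ : Finset E} (hF : P.IsProperFace F)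
    (hσ : (σ : Set E) = F ∩ P.vertices) : IsFaceSet ℝ P.vertices σ := by
  obtain ⟨hFP, l, c, hl⟩ := isExposed_iff_exists_forall_le.1 hF.1
  have hσV : σ ⊆ P.vertices := Finset.coe_subset.1 (hσ ▸ Set.inter_subset_right)
  have hconv : Convex ℝ F := hF.1.convex (P.convexHull_vertices ▸ convex_convexHull ℝ _)
  refine ⟨⟨hσV, fun hVσ => hF.2 (hFP.antisymm ?_)⟩, l, c, fun x hx => ?_⟩
  · rw [← P.convexHull_vertices]
    refine convexHull_min (fun v hv => ?_) hconv
    exact (hσ.subset (hVσ hv)).1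
  · rw [← Finset.mem_coe, hσ, Set.mem_inter_iff, and_iff_left (Finset.mem_coe.2 hx)]
    exact hl x (coe_vertices_subset_carrier hx)

theorem exists_isProperFace_of_isFaceSet {σ : Finset E} (hσ : IsFaceSet ℝ P.vertices σ) :
    ∃ F, P.IsProperFace F ∧ (σ : Set E) = F ∩ P.vertices := by
  obtain ⟨hσV, θ, c, hθ⟩ := hσ
  obtain ⟨l, hl⟩ := exists_strongDual_eqOn P.vertices θ
  replace hθ (x : E) (hx : x ∈ P.vertices) : l x ≤ c ∧ (l x = c ↔ x ∈ σ) := hl hx ▸ hθ x hx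
  have hle (x : E) (hx : x ∈ P.carrier) : l x ≤ c :=
    convexHull_min (fun v hv => (hθ v hv).1) (convex_halfSpace_le l.isLinear c)
      (P.convexHull_vertices.symm ▸ hx)
  obtain ⟨w, hw, hwσ⟩ := Finset.exists_of_ssubset hσV
  refine ⟨{x ∈ P.carrier | l x = c}, ⟨isExposed_iff_exists_forall_le.2
    ⟨Set.sep_subset _ _, l, c, fun x hx => ⟨hle x hx, (and_iff_right hx).symm⟩⟩, fun h => ?_⟩, ?_⟩
  · exact hwσ ((hθ w hw).2.1 (h.superset (coe_vertices_subset_carrier hw)).2)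
  · ext x
    exact ⟨fun hx => ⟨⟨coe_vertices_subset_carrier (hσV.1 hx), (hθ x (hσV.1 hx)).2.2 hx⟩, hσV.1 hx⟩,
      fun ⟨⟨_, hxc⟩, hx⟩ => (hθ x hx).2.1 hxc⟩

theorem coe_mem_boundaryComplex {σ : Finset E} :
    (σ : Set E) ∈ P.boundaryComplex ↔ IsFaceSet ℝ P.vertices σ :=
  ⟨fun ⟨_, hF, hσ⟩ => isFaceSet_of_isProperFace hF hσ, exists_isProperFace_of_isFaceSet⟩

theorem isSimplicialConfiguration_vertices (hP : P.IsSimplicial) (hV : P.vertices.Nontrivial) :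
    IsSimplicialConfiguration ℝ P.vertices where
  affineIndependent {σ} hσ := by
    obtain ⟨F, hF, hσF⟩ := exists_isProperFace_of_isFaceSet hσ
    obtain ⟨S, hS, hFS⟩ := hP F hF
    exact AffineIndependent.mono (t := (S : Set E)) hS
      (Finset.coe_subset.2 (subset_of_isProperFace_of_coe_eq_inter hF hσF hFS))
  isFaceSet_singleton {v} hv := by
    refine isFaceSet_of_isProperFace (F := {v}) ⟨?_, fun h => ?_⟩ ?_
    · exact mem_exposedPoints_iff_exposed_singleton.1 (mem_vertices.1 hv)
    · obtain ⟨w, hw, hwv⟩ := hV.exists_ne v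
      exact hwv (h.superset (coe_vertices_subset_carrier hw))
    · rw [Finset.coe_singleton, Set.inter_eq_left.2 (Set.singleton_subset_iff.2 hv)]

theorem coe_mem_restrictComplex_boundaryComplex (hV : IsSimplicialConfiguration ℝ P.vertices)
    {σ W : Finset E} :
    (σ : Set E) ∈ restrictComplex P.boundaryComplex W ↔ σ ⊆ W ∧ IsFaceSet ℝ P.vertices σ := by
  constructor
  · rintro ⟨F, hF, hσ⟩
    lift F to Finset E using finite_of_mem_boundaryComplex hF
    have hσFW := hσ.subset
    exact ⟨fun x hx => (hσFW hx).2,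
      hV.isFaceSet_of_subset (coe_mem_boundaryComplex.1 hF) fun x hx => (hσFW hx).1⟩
  · rintro ⟨hσW, hσ⟩
    exact ⟨σ, coe_mem_boundaryComplex.2 hσ, (Set.inter_eq_left.2 (Finset.coe_subset.2 hσW)).symm⟩

theorem finrank_reducedHomology_of_isFaceSet (hV : IsSimplicialConfiguration ℝ P.vertices)
    (k : Type*) [Field k] {W : Finset E} (hW : IsFaceSet ℝ P.vertices W) (hne : W.Nonempty)
    (d : ℤ) : Module.finrank k
      (SimplicialHomology.ReducedHomology k (restrictComplex P.boundaryComplex W) d) = 0 := by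
  classical
  obtain ⟨a, ha⟩ := hne
  refine SimplicialHomology.finrank_reducedHomology_eq_zero_of_insert_mem k (a := a)
    (fun F hF => ?_) d
  lift F to Finset E using finite_of_mem_restrictComplex hF
  have hins : insert a F ⊆ W :=
    Finset.insert_subset ha ((coe_mem_restrictComplex_boundaryComplex hV).1 hF).1
  rw [← Finset.coe_insert, coe_mem_restrictComplex_boundaryComplex hV]
  exact ⟨hins, hV.isFaceSet_of_subset hW hins⟩

theorem finrank_reducedHomology_zero_of_not_isFaceSet
    (hV : IsSimplicialConfiguration ℝ P.vertices) (k : Type*) [Field k] {W : Finset E}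
    (hWV : W ⊆ P.vertices) (hW2 : W.card = 2) (hW : ¬IsFaceSet ℝ P.vertices W) : Module.finrank k
      (SimplicialHomology.ReducedHomology k (restrictComplex P.boundaryComplex W) 0) = 1 := by
  have hsub : ∀ F ∈ restrictComplex P.boundaryComplex W, F.Subsingleton := by
    intro F hF
    lift F to Finset E using finite_of_mem_restrictComplex hF
    obtain ⟨hFW, hFV⟩ := (coe_mem_restrictComplex_boundaryComplex hV).1 hF
    have hlt := Finset.card_lt_card (hFW.ssubset_of_ne (by rintro rfl; exact hW hFV))
    exact fun x hx y hy => Finset.card_le_one.1 (by lia) x hx y hy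
  have hvert (v : E) : {v} ∈ restrictComplex P.boundaryComplex W ↔ v ∈ W := by
    rw [← Finset.coe_singleton, coe_mem_restrictComplex_boundaryComplex hV,
      Finset.singleton_subset_iff]
    exact and_iff_left_of_imp fun hv => hV.isFaceSet_singleton (hWV hv)
  have := SimplicialHomology.finrank_reducedHomology_zero_add_one k hsub hvert
    (Finset.card_pos.1 (by lia))
  lia

theorem specialBetti_two_add_card_facesOfCard_two (hV : IsSimplicialConfiguration ℝ P.vertices)
    (k : Type*) [Field k] :
    P.specialBetti k 2 + (facesOfCard ℝ P.vertices 2).card = P.vertices.card.choose 2 := by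
  classical
  have hterm : ∀ W ∈ P.vertices.powersetCard 2, Module.finrank k
      (SimplicialHomology.ReducedHomology k (restrictComplex P.boundaryComplex W) 0) =
        if ¬IsFaceSet ℝ P.vertices W then 1 else 0 := by
    intro W hW
    obtain ⟨hWV, hW2⟩ := Finset.mem_powersetCard.1 hW
    have hne : W.Nonempty := Finset.card_pos.1 (by lia)
    split_ifs with h
    · exact finrank_reducedHomology_of_isFaceSet hV k h hne 0
    · exact finrank_reducedHomology_zero_of_not_isFaceSet hV k hWV hW2 h
  have hfaces : facesOfCard ℝ P.vertices 2 =
      {W ∈ P.vertices.powersetCard 2 | IsFaceSet ℝ P.vertices W} := by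
    ext W
    rw [mem_facesOfCard, Finset.mem_filter, Finset.mem_powersetCard]
    exact ⟨fun h => ⟨⟨h.1.1.1, h.2⟩, h.1⟩, fun h => ⟨h.2, h.1.2⟩⟩
  have hdeg : ((2 : ℕ) : ℤ) - (((2 : ℕ) : ℤ) - 1) - 1 = 0 := by norm_num
  rw [specialBetti, gradedBetti, hdeg, Finset.sum_congr rfl hterm, ← Finset.card_filter, hfaces,
    add_comm, Finset.card_filter_add_card_filter_not, Finset.card_powersetCard]

end ConvexPolytope

theorem mainTheorem10_general {E : Type*} [AddCommGroup E] [Module ℝ E] [TopologicalSpace E]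
    [T2Space E] [IsTopologicalAddGroup E] [ContinuousSMul ℝ E] [LocallyConvexSpace ℝ E]
    (P : ConvexPolytope E) (hdim : P.dim = 3) (hsimp : P.IsSimplicial)
    (n : ℕ) (hn : P.vertices.card = n) (k : Type*) [Field k] :
    (n : ℝ) = (7 + √(8 * (P.specialBetti k 2 : ℝ) + 1)) / 2 ∧
      (P.specialBetti k 2 : ℤ) = (n.choose 2 : ℤ) - 3 * (n : ℤ) + 6 := by
  have hrank := P.finrank_vectorSpan_vertices.trans hdim
  have hcard : 3 < n := hn ▸ hrank ▸ finrank_vectorSpan_lt_card (K := ℝ) (hrank ▸ three_pos)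
  have hV := ConvexPolytope.isSimplicialConfiguration_vertices hsimp
    (Finset.one_lt_card_iff_nontrivial.1 (by lia))
  have hbetti := ConvexPolytope.specialBetti_two_add_card_facesOfCard_two hV k
  have hedges := hV.card_facesOfCard_two_add_six hrank
  have hb : (P.specialBetti k 2 : ℤ) = (n.choose 2 : ℤ) - 3 * (n : ℤ) + 6 := by lia
  have hsq : 8 * (P.specialBetti k 2 : ℝ) + 1 = (2 * n - 7) ^ 2 := by
    have hbℝ : (P.specialBetti k 2 : ℝ) = (n.choose 2 : ℝ) - 3 * n + 6 := by exact_mod_cast hb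
    rw [hbℝ, Nat.cast_choose_two]
    ring
  refine ⟨?_, hb⟩
  have hnℝ : (3 : ℝ) + 1 ≤ n := by exact_mod_cast hcard
  rw [hsq, Real.sqrt_sq (by linarith)]
  ring

theorem mainTheorem10 {m : ℕ} (P : ConvexPolytope (EuclideanSpace ℝ (Fin m)))
    (hdim : P.dim = 3) (hsimp : P.IsSimplicial)
    (n : ℕ) (hn : P.vertices.card = n) (k : Type*) [Field k] :
    (n : ℝ) = (7 + √(8 * (P.specialBetti k 2 : ℝ) + 1)) / 2 ∧
      (P.specialBetti k 2 : ℤ) = (n.choose 2 : ℤ) - 3 * (n : ℤ) + 6 :=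
  mainTheorem10_general P hdim hsimp n hn k
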